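/- Let $R$ be a complete, separated topological associative ring with unit in which open right ideals form a base of neighborhoods of zero. Let $H\subset R$ be a two-sided ideal such that: 1. $H$ is strongly closed: $H$ is closed in $R$, the quotient group $R/H$ is complete in the quotient topology, and for every set $X$ every $X$-indexed family of elements of $R/H$ converging to zero lifts to an $X$-indexed family of elements of $R$ converging to zero (a family in a topological abelian group converges to zero if every neighborhood of zero contains all but finitely many of its members); 2. $H$ is topologically left T-nilpotent: for every sequence $a_1,a_2,a_3,\dots$ of elements of $H$, the sequence of products $a_1,\ a_1a_2,\ a_1a_2a_3,\ \dots$ converges to zero in $R$; 3. the quotient ring $R/H$, with the quotient topology, is isomorphic as a topological ring to a product $\prod_{\gamma\in\Gamma}S_\gamma$, with the product topology, of some family of simple Artinian rings $S_\gamma$ viewed as discrete topological rings. Then every left $R$-contramodule has a projective cover. Here, for a set $X$, $R[[X]]$ denotes the set of all formal linear combinations $\sum_{x\in X}r_x x$ whose family of coefficients $(r_x)_{x\in X}$ in $R$ converges to zero. The assignment $X\mapsto R[[X]]$ is a monad on the category of sets: a map $f\colon X\to Y$ induces $\sum_x r_x x\mapsto\sum_{y}\bigl(\sum_{f(x)=y}r_x\bigr)y$,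 the unit $X\to R[[X]]$ sends $x$ to $1\cdot x$, and the multiplication $R[[R[[X]]]]\to R[[X]]$ opens the parentheses, $\sum_{y} r_y\, y\mapsto\sum_{x}\bigl(\sum_{y} r_y s_{y,x}\bigr)x$ for $y=\sum_x s_{y,x}x\in R[[X]]$, the infinite sums being limits of finite partial sums in $R$. A left $R$-contramodule is an algebra over this monad. A projective cover of an object $C$ of an abelian category with enough projective objects (here, the category of left $R$-contramodules) is an epimorphism $p\colon P\to C$ with $P$ projective such that every endomorphism $e\colon P\to P$ with $pe=p$ is an automorphism. -/

import Mathlib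

open Filter Topology CategoryTheory

universe u v w

/-! ### Families converging to zero -/

section ConvFam

variable (R : Type u) [Ring R] [UniformSpace R]

/-- `R[[X]]`: the set of all `X`-indexed families `(r_x)` of elements of `R` which converge to zero
in the topology of `R` (all but finitely many `r_x` lie in any given neighbourhood of zero),
interpreted as convergent formal linear combinations `∑ r_x x`. -/
def ConvFam (X : Type v) : Type (max u v) :=
  {a : X → R // Tendsto a cofinite (𝓝 0)}

namespace ConvFam

variable {R} {X : Type v} {Y : Type w}

instance : CoeFun (ConvFam R X) (fun _ => X → R) := ⟨Subtype.val⟩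

@[ext]
theorem ext {a b : ConvFam R X} (h : ∀ x, a x = b x) : a = b := Subtype.ext (funext h)

variable [IsUniformAddGroup R] [IsTopologicalRing R] [IsLinearTopology Rᵐᵒᵖ R]

/-- A ring whose open right ideals form a base at zero is non-archimedean. -/
theorem nonarchimedean : NonarchimedeanAddGroup R where
  is_nonarchimedean U hU := by
    obtain ⟨I, hI, hIU⟩ :=
      (IsLinearTopology.hasBasis_open_submodule (R := Rᵐᵒᵖ) (M := R)).mem_iff.1 hU
    exact ⟨⟨I.toAddSubgroup, hI⟩, hIU⟩

theorem summable [CompleteSpace R] {f : X → R} (hf : Tendsto f cofinite (𝓝 0)) : Summable f :=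
  haveI := nonarchimedean (R := R)
  NonarchimedeanAddGroup.summable_of_tendsto_cofinite_zero hf

theorem tendsto_mul_right {a : X → R} (ha : Tendsto a cofinite (𝓝 0)) (b : X → R) :
    Tendsto (fun x => a x * b x) cofinite (𝓝 0) :=
  IsLinearTopology.tendsto_mul_zero_of_left a b ha

/-- If `a x → 0`, and `g x y → 0` in `y` for every `x`, then `a x * g x y → 0` in `(x, y)`. -/
theorem tendsto_prod {a : X → R} (ha : Tendsto a cofinite (𝓝 0)) {g : X → Y → R}
    (hg : ∀ x, Tendsto (g x) cofinite (𝓝 0)) :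
    Tendsto (fun p : X × Y => a p.1 * g p.1 p.2) cofinite (𝓝 0) := by
  rw [(IsLinearTopology.hasBasis_submodule (R := Rᵐᵒᵖ) (M := R)).tendsto_right_iff]
  intro I hI
  have hF : {x | ¬ a x ∈ I}.Finite := ha hI
  have hx : ∀ x, {y | ¬ a x * g x y ∈ I}.Finite := fun x => by
    have h : Tendsto (fun y => a x * g x y) cofinite (𝓝 0) := by
      simpa using (hg x).const_mul (a x)
    exact h hI
  refine Set.Finite.subset (hF.biUnion fun x _ => (hx x).image (fun y => (x, y))) ?_
  rintro ⟨x, y⟩ hxy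
  have hxy' : ¬ a x * g x y ∈ I := hxy
  simp only [Set.mem_iUnion]
  exact ⟨x, fun h => hxy' (I.smul_mem (MulOpposite.op (g x y)) h), y, hxy', rfl⟩

/-- If `f (x, y) → 0` in `(x, y)`, then the sums over `x` converge to zero in `y`. -/
theorem tendsto_tsum {f : X × Y → R} (hf : Tendsto f cofinite (𝓝 0)) :
    Tendsto (fun y => ∑' x, f (x, y)) cofinite (𝓝 0) := by
  rw [(IsLinearTopology.hasBasis_open_submodule (R := Rᵐᵒᵖ) (M := R)).tendsto_right_iff]
  intro I hI
  have hF : {p | ¬ f p ∈ I}.Finite := hf (hI.mem_nhds I.zero_mem)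
  refine Set.Finite.subset (hF.image Prod.snd) ?_
  intro y hy
  by_contra hcon
  have hcl : IsClosed (I : Set R) := AddSubgroup.isClosed_of_isOpen I.toAddSubgroup hI
  refine hy (tsum_mem hcl fun x => ?_)
  by_contra hx
  exact hcon ⟨(x, y), hx, rfl⟩

/-- The substitution of convergent formal linear combinations `g x = ∑_y g_{x,y} y` into
`∑_x a_x x`; the coefficient at `y` is `∑_x a_x g_{x,y}`. -/
noncomputable def subst (a : ConvFam R X) (g : X → ConvFam R Y) : ConvFam R Y :=
  ⟨fun y => ∑' x, a x * g x y, tendsto_tsum (tendsto_prod a.2 fun x => (g x).2)⟩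

open Classical in
/-- The point measure `1 · x₀`. -/
noncomputable def point (x₀ : X) : ConvFam R X :=
  ⟨fun x => if x = x₀ then 1 else 0, by
    refine tendsto_nhds.2 fun U _ h0 => Set.Finite.subset (Set.finite_singleton x₀) fun x hx => ?_
    by_contra hne
    exact hx (by simpa [show x ≠ x₀ from hne] using h0)⟩

theorem tsum_fiber (a : X → R) (f : X → Y) (y : Y) :
    ∑' x : f ⁻¹' {y}, a x = ∑' x, a x * (point (R := R) (f x) : ConvFam R Y) y := by
  classical
  rw [tsum_subtype (f ⁻¹' {y}) a]
  refine tsum_congr fun x => ?_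
  simp [point, Set.indicator_apply, eq_comm]

/-- The map `R[[f]] : R[[X]] → R[[Y]]`, `∑_x a_x x ↦ ∑_y (∑_{f x = y} a_x) y`. -/
noncomputable def map (f : X → Y) (a : ConvFam R X) : ConvFam R Y :=
  ⟨fun y => ∑' x : f ⁻¹' {y}, a x, by
    simp only [tsum_fiber]
    exact (subst a fun x => point (f x)).2⟩

/-- Opening of parentheses `R[[R[[X]]]] → R[[X]]`: the coefficient of the result at `x` is
`∑_y r_y y_x`, where `y` ranges over `R[[X]]`. -/
noncomputable def join (r : ConvFam R (ConvFam R X)) : ConvFam R X :=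
  ⟨fun x => ∑' y : ConvFam R X, r y * y x, (subst r fun y => y).2⟩

theorem map_eq_subst (f : X → Y) (a : ConvFam R X) : map f a = subst a fun x => point (f x) :=
  ext fun y => tsum_fiber a f y

theorem join_eq_subst (r : ConvFam R (ConvFam R X)) : join r = subst r fun y => y := rfl

theorem subst_point (a : ConvFam R X) : subst a point = a := by
  classical
  refine ext fun x => ?_
  change ∑' z, a z * (if x = z then 1 else 0) = a x
  rw [tsum_eq_single x (fun z hz => by simp [hz.symm])]
  simp

theorem point_subst (x : X) (g : X → ConvFam R Y) : subst (point x) g = g x := by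
  classical
  refine ext fun y => ?_
  change ∑' z, (if z = x then 1 else 0) * g z y = g x y
  rw [tsum_eq_single x (fun z hz => by simp [hz])]
  simp

theorem subst_assoc [CompleteSpace R] [T2Space R] {Z : Type*} (a : ConvFam R X)
    (g : X → ConvFam R Y) (h : Y → ConvFam R Z) :
    subst (subst a g) h = subst a fun x => subst (g x) h := by
  refine ext fun z => ?_
  change ∑' y, (∑' x, a x * g x y) * h y z = ∑' x, a x * ∑' y, g x y * h y z
  have hgh : ∀ x, Tendsto (fun y => g x y * h y z) cofinite (𝓝 0) := fun x =>
    tendsto_mul_right (g x).2 _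
  have key : Summable (Function.uncurry fun x y => a x * (g x y * h y z)) :=
    summable (tendsto_prod a.2 hgh)
  calc ∑' y, (∑' x, a x * g x y) * h y z
      = ∑' y, ∑' x, a x * (g x y * h y z) := tsum_congr fun y => by
        rw [← (summable (tendsto_mul_right a.2 fun x => g x y)).tsum_mul_right]
        simp only [mul_assoc]
    _ = ∑' x, ∑' y, a x * (g x y * h y z) := key.tsum_comm
    _ = _ := tsum_congr fun x => (summable (hgh x)).tsum_mul_left _

end ConvFam

end ConvFam

/-! ### Contramodules -/

section Contramodule

variable (R : Type u) [Ring R] [UniformSpace R] [IsUniformAddGroup R] [IsTopologicalRing R]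
  [IsLinearTopology Rᵐᵒᵖ R] [CompleteSpace R] [T2Space R]

open ConvFam in
/-- The monad `X ↦ R[[X]]` on the category of sets, for a complete, separated topological ring `R`
with a base of neighbourhoods of zero formed by open right ideals. -/
noncomputable def contraMonad : Monad (Type u) where
  obj X := ConvFam R X
  map f := TypeCat.ofHom (ConvFam.map f)
  map_id X := by
    ext a : 3
    exact (map_eq_subst _ _).trans (subst_point a)
  map_comp f g := by
    ext a : 3
    change ConvFam.map (g ∘ f) a = ConvFam.map g (ConvFam.map f a)
    simp only [map_eq_subst, subst_assoc, point_subst, Function.comp]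
  η :=
    { app X := TypeCat.ofHom point
      naturality X Y f := by
        ext x : 3
        change point (f x) = ConvFam.map f (point x)
        rw [map_eq_subst, point_subst] }
  μ :=
    { app X := TypeCat.ofHom join
      naturality X Y f := by
        ext r : 3
        change join (ConvFam.map (ConvFam.map f) r) = ConvFam.map f (join r)
        simp only [join_eq_subst, map_eq_subst, subst_assoc, point_subst] }
  assoc X := by
    ext r : 3
    change join (ConvFam.map join r) = join (join r)
    simp only [join_eq_subst, map_eq_subst, subst_assoc, point_subst]
  left_unit X := by
    ext a : 3
    change join (point a) = a
    rw [join_eq_subst, point_subst]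
  right_unit X := by
    ext a : 3
    change join (ConvFam.map point a) = a
    simp only [join_eq_subst, map_eq_subst, subst_assoc, point_subst, subst_point]

/-- The category of left `R`-contramodules: algebras over the monad `X ↦ R[[X]]`. -/
abbrev Contramodule : Type (u + 1) := (contraMonad R).Algebra

end Contramodule

/-! ### Projective covers -/

/-- An epimorphism `p : P ⟶ C` is a projective cover of `C` if `P` is projective and every
endomorphism `e` of `P` with `p ∘ e = p` is an automorphism. -/
structure IsProjectiveCover {B : Type u} [Category.{v} B] {P C : B} (p : P ⟶ C) : Prop where
  epi : Epi p
  projective : Projective P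
  isIso_of_comp_eq : ∀ e : P ⟶ P, e ≫ p = p → IsIso e

/-! ### Strongly closed and T-nilpotent ideals -/

/-- A subgroup `H` of a (complete, separated) topological abelian group `A` is strongly closed if it
is closed, the quotient group `A ⧸ H` is complete in the quotient topology, and for every set `X`
the map `A[[X]] → (A ⧸ H)[[X]]` is surjective, i.e. every family in `A ⧸ H` converging to zero lifts
to a family in `A` converging to zero. -/
structure IsStronglyClosed {A : Type u} [AddCommGroup A] [TopologicalSpace A]
    [IsTopologicalAddGroup A] (H : AddSubgroup A) : Prop where
  isClosed : IsClosed (H : Set A)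
  complete : @CompleteSpace (A ⧸ H) (IsTopologicalAddGroup.rightUniformSpace (A ⧸ H))
  lift : ∀ (X : Type u) (b : X → A ⧸ H), Tendsto b cofinite (𝓝 0) →
    ∃ a : X → A, Tendsto a cofinite (𝓝 0) ∧ ∀ x, (QuotientAddGroup.mk (a x) : A ⧸ H) = b x

/-- `H` is topologically left T-nilpotent: for every sequence `a₀, a₁, a₂, …` in `H`, the sequence
of products `a₀, a₀ a₁, a₀ a₁ a₂, …` converges to zero. -/
def IsTopLeftTNilpotent {R : Type u} [Ring R] [TopologicalSpace R] (H : Ideal R) : Prop :=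
  ∀ a : ℕ → R, (∀ n, a n ∈ H) →
    Tendsto (fun n : ℕ => ((List.range (n + 1)).map a).prod) atTop (𝓝 0)

/-! Topological T-nilpotence of `H` makes the geometric series of a row-convergent matrix over `H`
converge (König's lemma), so that such matrices can be subtracted from `1`: this gives Nakayama's
lemma for contramodules, and shows that an endomorphism of `∐ R e_x` which is the identity modulo
`H` is invertible. Hence a projective cover of `C` arises as soon as the reduction `C / HC` is
identified with `∐ R e_x` modulo `H`. A contramodule over the product `R / H = ∏ S_γ` is the product
of its components, and these are semisimple modules over the `S_γ`. So its socle is a direct sum of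
simple modules generating it, and each of them is `S_γ g` for an idempotent `g`, which lifts to an
idempotent of `R`. -/

namespace ConvFam

section Linear

variable {R : Type u} [Ring R] [UniformSpace R] {X : Type v} {Y : Type w}

@[simp] theorem point_apply_self (x : X) : (point x : ConvFam R X) x = 1 := if_pos rfl

theorem point_apply_of_ne {x y : X} (h : y ≠ x) : (point x : ConvFam R X) y = 0 := if_neg h

variable [IsTopologicalRing R]

variable (R X) in
/-- The families converging to zero, as a submodule of the module of all families; it provides the
`R`-module structure of `R[[X]]`. -/
def submodule : Submodule R (X → R) where
  carrier := {a | Tendsto a cofinite (𝓝 0)}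
  add_mem' ha hb := (zero_add (0 : R)) ▸ Tendsto.add ha hb
  zero_mem' := tendsto_const_nhds
  smul_mem' r _ ha := (mul_zero r) ▸ Tendsto.const_mul r ha

noncomputable instance : AddCommGroup (ConvFam R X) :=
  inferInstanceAs (AddCommGroup (submodule R X))

noncomputable instance : Module R (ConvFam R X) :=
  inferInstanceAs (Module R (submodule R X))

@[simp] theorem add_apply (a b : ConvFam R X) (x : X) : (a + b) x = a x + b x := rfl
@[simp] theorem sub_apply (a b : ConvFam R X) (x : X) : (a - b) x = a x - b x := rfl
@[simp] theorem zero_apply (x : X) : (0 : ConvFam R X) x = 0 := rfl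
@[simp] theorem smul_apply (r : R) (a : ConvFam R X) (x : X) : (r • a) x = r * a x := rfl

variable [IsUniformAddGroup R] [IsLinearTopology Rᵐᵒᵖ R]

theorem subst_apply (a : ConvFam R X) (g : X → ConvFam R Y) (y : Y) :
    subst a g y = ∑' x, a x * g x y := rfl

theorem subst_point_comp (a : ConvFam R X) (f : X → Y) : subst a (fun x => point (f x)) = map f a :=
  (map_eq_subst f a).symm

theorem subst_smul_point_apply (a : ConvFam R X) (r : X → R) (x : X) :
    subst a (fun x => r x • point x) x = a x * r x := by
  rw [subst_apply, tsum_eq_single x fun z hz => by simp [point_apply_of_ne hz.symm]]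
  simp

variable [CompleteSpace R]

theorem summable_mul (a : ConvFam R X) (b : X → R) : Summable fun x => a x * b x :=
  summable (tendsto_mul_right a.2 b)

variable [T2Space R]

/-- Substitution of a fixed row-convergent matrix `g`, i.e. `a ↦ a g` for row vectors `a`, as a
linear map. -/
noncomputable def substₗ (g : X → ConvFam R Y) : ConvFam R X →ₗ[R] ConvFam R Y where
  toFun a := subst a g
  map_add' a b := by
    ext y
    simp only [subst_apply, add_apply, add_mul]
    exact (summable_mul a _).tsum_add (summable_mul b _)
  map_smul' r a := by
    ext y
    simp only [subst_apply, smul_apply, mul_assoc, RingHom.id_apply]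
    exact (summable_mul a _).tsum_mul_left r

@[simp] theorem substₗ_apply (g : X → ConvFam R Y) (a : ConvFam R X) : substₗ g a = subst a g := rfl

theorem subst_add (a : ConvFam R X) (g h : X → ConvFam R Y) :
    subst a (g + h) = subst a g + subst a h := by
  ext y
  simp only [subst_apply, Pi.add_apply, add_apply, mul_add]
  exact (summable_mul a _).tsum_add (summable_mul a _)

theorem subst_sub (a : ConvFam R X) (g h : X → ConvFam R Y) :
    subst a (g - h) = subst a g - subst a h := by
  rw [eq_sub_iff_add_eq, ← subst_add, sub_add_cancel]

end Linear

section RightIdeal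

variable {R : Type u} [Ring R] [UniformSpace R]
  {I : Submodule Rᵐᵒᵖ R} {X : Type v} {Y : Type w}

theorem finite_notMem (hI : IsOpen (I : Set R)) (a : ConvFam R X) : {x | a x ∉ I}.Finite :=
  a.2 (hI.mem_nhds I.zero_mem)

variable [IsTopologicalRing R]

theorem isClosed_of_isOpen (hI : IsOpen (I : Set R)) : IsClosed (I : Set R) :=
  AddSubgroup.isClosed_of_isOpen I.toAddSubgroup hI

theorem subst_apply_mem [IsUniformAddGroup R] [IsLinearTopology Rᵐᵒᵖ R]
    (hI : IsOpen (I : Set R)) {a : ConvFam R X} {g : X → ConvFam R Y} {y : Y}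
    (h : ∀ x, a x * g x y ∈ I) : subst a g y ∈ I :=
  tsum_mem (isClosed_of_isOpen hI) h

end RightIdeal

section ClosedIdeal

variable {R : Type u} [Ring R] [UniformSpace R] [IsTopologicalRing R] [IsUniformAddGroup R]
  [IsLinearTopology Rᵐᵒᵖ R] {H : Ideal R} {X : Type v} {Y : Type w}

theorem subst_apply_mem_of_left [H.IsTwoSided] (hH : IsClosed (H : Set R)) {a : ConvFam R X}
    (ha : ∀ x, a x ∈ H) (g : X → ConvFam R Y) (y : Y) : subst a g y ∈ H :=
  tsum_mem (s := H) hH fun x => H.mul_mem_right _ (ha x)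

theorem subst_apply_mem_of_right (hH : IsClosed (H : Set R)) (a : ConvFam R X)
    {g : X → ConvFam R Y} (hg : ∀ x y, g x y ∈ H) (y : Y) : subst a g y ∈ H :=
  tsum_mem (s := H) hH fun x => H.mul_mem_left _ (hg x y)

end ClosedIdeal

section TNilpotent

variable {R : Type u} [Ring R] [UniformSpace R] [IsUniformAddGroup R] [IsTopologicalRing R]
  [IsLinearTopology Rᵐᵒᵖ R] [CompleteSpace R] [T2Space R] {H : Ideal R} {X : Type v}
  {φ : X → ConvFam R X} {I : Submodule Rᵐᵒᵖ R}

theorem substₗ_pow_apply (φ : X → ConvFam R X) (n : ℕ) (a : ConvFam R X) :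
    (substₗ φ ^ n) a = subst a fun x => (substₗ φ ^ n) (point x) := by
  induction n with
  | zero => exact (subst_point a).symm
  | succ n ih =>
    simp only [pow_succ', Module.End.mul_apply, substₗ_apply]
    rw [ih, subst_assoc]

variable (φ I) in
/-- For large `n`, all coefficients of the `n`-th iterate `a φⁿ` of the row vector `a` under the
matrix `φ` lie in the right ideal `I`. -/
def IteratesEventuallyMem (a : ConvFam R X) : Prop :=
  ∀ᶠ n in atTop, ∀ y, (substₗ φ ^ n) a y ∈ I

namespace IteratesEventuallyMem

theorem of_smul_point (hI : IsOpen (I : Set R)) {a : ConvFam R X}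
    (h : ∀ x, IteratesEventuallyMem φ I (a x • point x)) : IteratesEventuallyMem φ I a := by
  have hF : ∀ᶠ n in atTop, ∀ x ∈ {x | a x ∉ I}, ∀ y, (substₗ φ ^ n) (a x • point x) y ∈ I :=
    (finite_notMem hI a).eventually_all.2 fun x _ => h x
  filter_upwards [hF] with n hn y
  rw [substₗ_pow_apply]
  refine subst_apply_mem hI fun x => ?_
  by_cases hx : a x ∈ I
  · exact I.smul_mem (MulOpposite.op _) hx
  · simpa only [map_smul, smul_apply] using hn x hx y

theorem of_mem {r : R} (hr : r ∈ I) (x : X) : IteratesEventuallyMem φ I (r • point x) :=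
  .of_forall fun n y => by
    rw [map_smul]
    exact I.smul_mem (MulOpposite.op _) hr

theorem of_subst {a : ConvFam R X} (h : IteratesEventuallyMem φ I (subst a φ)) :
    IteratesEventuallyMem φ I a := by
  rw [IteratesEventuallyMem, ← map_add_atTop_eq_nat 1, eventually_map]
  simpa only [IteratesEventuallyMem, pow_succ, Module.End.mul_apply, substₗ_apply] using h

/- König's lemma: a failure at `r • point x` propagates along an infinite sequence of indices, and
the products of the entries of `φ` along this sequence would not converge to zero. -/
theorem smul_point (hI : IsOpen (I : Set R)) (hnil : IsTopLeftTNilpotent H)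
    (hφ : ∀ x y, φ x y ∈ H) (r : R) (x : X) : IteratesEventuallyMem φ I (r • point x) := by
  by_contra hrx
  have step (r : R) (x : X) (h : ¬ IteratesEventuallyMem φ I (r • point x)) :
      ∃ y, ¬ IteratesEventuallyMem φ I ((r * φ x y) • point y) := by
    by_contra! hall
    refine h (of_subst (of_smul_point hI fun y => ?_))
    rw [← substₗ_apply, map_smul, substₗ_apply, point_subst]
    exact hall y
  choose! next hnext using step
  let q : ℕ → R × X :=
    Nat.rec (r, x) fun _ p => (p.1 * φ p.2 (next p.1 p.2), next p.1 p.2)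
  have hq (n : ℕ) : ¬ IteratesEventuallyMem φ I ((q n).1 • point (q n).2) := by
    induction n with
    | zero => exact hrx
    | succ n ih => exact hnext _ _ ih
  let h (n : ℕ) : R := φ (q n).2 (q (n + 1)).2
  have hprod (n : ℕ) : (q n).1 = r * ((List.range n).map h).prod := by
    induction n with
    | zero => simp [q]
    | succ n ih =>
      rw [List.range_succ, List.map_append, List.prod_append, ← mul_assoc, ← ih]
      simp [q, h]
  have hlim : Tendsto (fun n => (q (n + 1)).1) atTop (𝓝 0) := by
    simpa only [hprod, mul_zero] using (hnil h fun n => hφ _ _).const_mul r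
  obtain ⟨n, hn⟩ := (hlim.eventually (hI.mem_nhds I.zero_mem)).exists
  exact hq (n + 1) (of_mem hn _)

end IteratesEventuallyMem

theorem tendsto_substₗ_pow (hnil : IsTopLeftTNilpotent H) (hφ : ∀ x y, φ x y ∈ H)
    (a : ConvFam R X) :
    Tendsto (fun p : ℕ × X => (substₗ φ ^ p.1) a p.2) cofinite (𝓝 0) := by
  rw [(IsLinearTopology.hasBasis_open_submodule (R := Rᵐᵒᵖ) (M := R)).tendsto_right_iff]
  intro I hI
  obtain ⟨N, hN⟩ := eventually_atTop.1 <|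
    IteratesEventuallyMem.of_smul_point hI fun x => .smul_point hI hnil hφ (a x) x
  refine ((Set.finite_lt_nat N).biUnion fun n _ =>
    (finite_notMem hI ((substₗ φ ^ n) a)).image (Prod.mk n)).subset ?_
  rintro ⟨n, y⟩ hny
  exact Set.mem_biUnion (not_le.1 fun hn => hny (hN n hn y)) ⟨y, hny, rfl⟩

theorem eq_zero_of_subst_eq_self (hnil : IsTopLeftTNilpotent H) (hφ : ∀ x y, φ x y ∈ H)
    {a : ConvFam R X} (ha : subst a φ = a) : a = 0 := by
  have hpow (n : ℕ) : (substₗ φ ^ n) a = a := by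
    rw [Module.End.pow_apply]
    exact Function.iterate_fixed ha n
  ext y
  have hlim := (tendsto_substₗ_pow hnil hφ a).comp
    (Prod.mk_left_injective y).tendsto_cofinite
  simpa only [Function.comp_def, hpow, tendsto_const_nhds_iff, zero_apply] using hlim

/- The preimage is the geometric series `∑ a φⁿ`. -/
theorem exists_sub_subst_eq (hnil : IsTopLeftTNilpotent H) (hφ : ∀ x y, φ x y ∈ H)
    (a : ConvFam R X) : ∃ b : ConvFam R X, b - subst b φ = a := by
  have hpow := tendsto_substₗ_pow hnil hφ a
  have hsum (y : X) : Summable fun n : ℕ => (substₗ φ ^ n) a y :=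
    summable (hpow.comp (Prod.mk_left_injective y).tendsto_cofinite)
  have hprod (z : X) : Summable (Function.uncurry fun n y => (substₗ φ ^ n) a y * φ y z) :=
    summable (tendsto_mul_right hpow fun p => φ p.2 z)
  let b : ConvFam R X := ⟨fun y => ∑' n, (substₗ φ ^ n) a y, tendsto_tsum hpow⟩
  have hb (z : X) : subst b φ z = ∑' n, (substₗ φ ^ (n + 1)) a z :=
    calc ∑' y, (∑' n, (substₗ φ ^ n) a y) * φ y z
        = ∑' y, ∑' n, (substₗ φ ^ n) a y * φ y z :=
          tsum_congr fun y => ((hsum y).tsum_mul_right _).symm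
      _ = ∑' n, ∑' y, (substₗ φ ^ n) a y * φ y z := (hprod z).tsum_comm
      _ = ∑' n, (substₗ φ ^ (n + 1)) a z := by
          simp only [pow_succ', Module.End.mul_apply, substₗ_apply, subst_apply]
  refine ⟨b, ext fun z => ?_⟩
  rw [sub_apply, hb]
  exact sub_eq_of_eq_add (hsum z).tsum_eq_zero_add

theorem bijective_subst_of_sub_point_mem (hnil : IsTopLeftTNilpotent H) {g : X → ConvFam R X}
    (hg : ∀ x y, g x y - (point x : ConvFam R X) y ∈ H) :
    Function.Bijective fun a : ConvFam R X => subst a g := by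
  let φ : X → ConvFam R X := point - g
  have hφ (x y) : φ x y ∈ H := by simpa [φ] using H.neg_mem (hg x y)
  have hsub (a : ConvFam R X) : subst a g = a - subst a φ := by
    rw [subst_sub, subst_point, sub_sub_cancel]
  constructor
  · refine (injective_iff_map_eq_zero (substₗ g)).2 fun a ha => ?_
    rw [substₗ_apply, hsub, sub_eq_zero] at ha
    exact eq_zero_of_subst_eq_self hnil hφ ha.symm
  · intro a
    simpa only [hsub] using exists_sub_subst_eq hnil hφ a

end TNilpotent

end ConvFam

/-! ### Linear combinations in contramodules -/

namespace Contramodule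

open ConvFam

variable {R : Type u} [Ring R] [UniformSpace R] [IsUniformAddGroup R] [IsTopologicalRing R]
  [IsLinearTopology Rᵐᵒᵖ R] [CompleteSpace R] [T2Space R]

section Linear

variable {A : Contramodule R} {X : Type v} {Y : Type w}

variable (A) in
/-- The structure map `R[[A]] → A` of a contramodule. -/
noncomputable def act (a : ConvFam R A.A) : A.A :=
  (A.a : _ → A.A) a

theorem act_point (m : A.A) : A.act (point m) = m :=
  ConcreteCategory.congr_hom A.unit m

theorem act_join (r : ConvFam R (ConvFam R A.A)) : A.act (join r) = A.act (map A.act r) :=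
  ConcreteCategory.congr_hom A.assoc r

theorem act_surjective : Function.Surjective A.act := fun m => ⟨point m, act_point m⟩

theorem act_substₗ (r : ConvFam R (ConvFam R A.A)) :
    A.act (substₗ id r) = A.act (substₗ (fun a => point (A.act a)) r) :=
  (act_join r).trans (congrArg A.act (map_eq_subst _ r))

noncomputable instance : Zero A.A := ⟨A.act 0⟩
noncomputable instance : Add A.A := ⟨fun m n => A.act (point m + point n)⟩
noncomputable instance : SMul R A.A := ⟨fun r m => A.act (r • point m)⟩
noncomputable instance : SMul ℕ A.A := ⟨fun n m => (n : R) • m⟩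

theorem act_add (a b : ConvFam R A.A) : A.act (a + b) = A.act a + A.act b := by
  have h := act_substₗ (point a + point b)
  simp only [map_add, substₗ_apply, point_subst] at h
  exact h

theorem act_smul (r : R) (a : ConvFam R A.A) : A.act (r • a) = r • A.act a := by
  have h := act_substₗ (r • point a)
  simp only [map_smul, substₗ_apply, point_subst] at h
  exact h

noncomputable instance : AddCommMonoid A.A :=
  act_surjective.addCommMonoid A.act rfl act_add fun a n => by
    rw [← Nat.cast_smul_eq_nsmul R, act_smul]
    rfl

noncomputable instance : Module R A.A :=
  act_surjective.module R ⟨⟨A.act, rfl⟩, act_add⟩ act_smul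

noncomputable instance : AddCommGroup A.A := Module.addCommMonoidToAddCommGroup R

/-- The infinite linear combinations `∑ a_x f(x)` of a family of elements of a contramodule. -/
noncomputable def linearCombination (f : X → A.A) : ConvFam R X →ₗ[R] A.A where
  toFun a := A.act (map f a)
  map_add' a b := by simp only [map_eq_subst, ← substₗ_apply, map_add, act_add]
  map_smul' r a := by simp only [map_eq_subst, ← substₗ_apply, map_smul, act_smul, RingHom.id_apply]

theorem linearCombination_apply (f : X → A.A) (a : ConvFam R X) :
    linearCombination f a = A.act (map f a) := rfl

theorem linearCombination_id (a : ConvFam R A.A) : linearCombination id a = A.act a := by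
  rw [linearCombination_apply, map_eq_subst]
  exact congrArg A.act (subst_point a)

@[simp] theorem linearCombination_point (f : X → A.A) (x : X) :
    linearCombination f (point x) = f x := by
  rw [linearCombination_apply, map_eq_subst, point_subst, act_point]

theorem linearCombination_subst (f : Y → A.A) (a : ConvFam R X) (g : X → ConvFam R Y) :
    linearCombination f (subst a g) = linearCombination (fun x => linearCombination f (g x)) a := by
  have h := act_join (map (fun x => map f (g x)) a)
  simp only [join_eq_subst, map_eq_subst, subst_assoc, point_subst] at h
  simpa only [linearCombination_apply, map_eq_subst, subst_assoc] using h

theorem linearCombination_map (f : Y → A.A) (g : X → Y) (a : ConvFam R X) :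
    linearCombination f (map g a) = linearCombination (f ∘ g) a := by
  simp only [map_eq_subst, linearCombination_subst, linearCombination_point, Function.comp_def]

theorem linearCombination_add (f g : X → A.A) :
    linearCombination (f + g) = linearCombination f + linearCombination g := by
  ext a
  have h := linearCombination_subst id a ((fun x => point (f x)) + fun x => point (g x))
  simp only [subst_add, subst_point_comp, map_add, linearCombination_map, Pi.add_apply,
    linearCombination_point] at h
  exact h.symm

theorem linearCombination_zero : linearCombination (0 : X → A.A) = 0 := by
  simpa using linearCombination_add (0 : X → A.A) 0

theorem linearCombination_sub (f g : X → A.A) :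
    linearCombination (f - g) = linearCombination f - linearCombination g := by
  rw [eq_sub_iff_add_eq, ← linearCombination_add, sub_add_cancel]

end Linear

section Hom

variable {A B C : Contramodule R} {X : Type v}

theorem hom_linearCombination (f : A ⟶ B) (g : X → A.A) (a : ConvFam R X) :
    f.f (linearCombination g a) = linearCombination (fun x => f.f (g x)) a := by
  have h (b : ConvFam R A.A) : f.f (A.act b) = linearCombination f.f b :=
    (ConcreteCategory.congr_hom f.h b).symm
  rw [linearCombination_apply, h, linearCombination_map]
  rfl

/-- A homomorphism of contramodules, as a linear map of the underlying modules. -/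
noncomputable def toLinearMap (f : A ⟶ B) : A.A →ₗ[R] B.A where
  toFun := f.f
  map_add' m n := by
    have h := hom_linearCombination f id (point m + point n)
    simpa only [map_add, linearCombination_point, id_eq] using h
  map_smul' r m := by
    have h := hom_linearCombination f id (r • point m)
    simpa only [map_smul, linearCombination_point, id_eq, RingHom.id_apply] using h

@[simp] theorem toLinearMap_apply (f : A ⟶ B) (m : A.A) : toLinearMap f m = f.f m := rfl

/-- The homomorphism of contramodules given by a map which preserves infinite linear
combinations. -/
noncomputable def homMk (f : A.A → B.A)
    (h : ∀ a : ConvFam R A.A, f (linearCombination id a) = linearCombination f a) : A ⟶ B where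
  f := TypeCat.ofHom f
  h := by
    ext a : 3
    exact (h a).symm.trans (congrArg f (linearCombination_id a))

@[simp] theorem comp_apply (f : A ⟶ B) (g : B ⟶ C) (m : A.A) : (f ≫ g).f m = g.f (f.f m) := rfl

theorem hom_ext {f g : A ⟶ B} (h : ∀ m, f.f m = g.f m) : f = g := by
  apply Monad.Algebra.Hom.ext
  ext m
  exact h m

theorem epi_of_surjective (f : A ⟶ B) (hf : Function.Surjective f.f) : Epi f where
  left_cancellation g h hgh := hom_ext fun m => by
    obtain ⟨n, rfl⟩ := hf m
    rw [← comp_apply, hgh, comp_apply]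

theorem isIso_of_bijective (f : A ⟶ B) (hf : Function.Bijective f.f) : IsIso f := by
  have : IsIso f.f := (isIso_iff_bijective f.f).2 hf
  exact Monad.algebra_iso_of_iso _ f

end Hom

section Quotient

variable {A B : Contramodule R} {X : Type v} {N : Submodule R A.A}

/-- A submodule of a contramodule is a subcontramodule if it is closed under infinite linear
combinations. -/
def IsSubcontramodule (N : Submodule R A.A) : Prop :=
  ∀ a : ConvFam R N, linearCombination ((↑) : N → A.A) a ∈ N

namespace IsSubcontramodule

theorem linearCombination_mem (hN : IsSubcontramodule N) {f : X → A.A} (hf : ∀ x, f x ∈ N)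
    (a : ConvFam R X) : linearCombination f a ∈ N := by
  simpa only [linearCombination_map, Function.comp_def] using
    hN (map (fun x => (⟨f x, hf x⟩ : N)) a)

theorem mkQ_linearCombination_congr (hN : IsSubcontramodule N) {f g : X → A.A}
    (h : ∀ x, N.mkQ (f x) = N.mkQ (g x)) (a : ConvFam R X) :
    N.mkQ (linearCombination f a) = N.mkQ (linearCombination g a) := by
  rw [Submodule.mkQ_apply, Submodule.mkQ_apply, Submodule.Quotient.eq, ← LinearMap.sub_apply,
    ← linearCombination_sub]
  exact hN.linearCombination_mem (fun x => (Submodule.Quotient.eq N).1 (h x)) a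

/-- The quotient of a contramodule by a subcontramodule. -/
noncomputable def quotient (hN : IsSubcontramodule N) : Contramodule R where
  A := A.A ⧸ N
  a := TypeCat.ofHom fun a : ConvFam R (A.A ⧸ N) => N.mkQ (linearCombination Quotient.out a)
  unit := by
    ext q
    change N.mkQ (linearCombination Quotient.out (point q)) = q
    rw [linearCombination_point]
    exact Quotient.out_eq q
  assoc := by
    have key (r : ConvFam R (ConvFam R (A.A ⧸ N))) :
        N.mkQ (linearCombination Quotient.out (join r)) = N.mkQ (linearCombination Quotient.out
          (map (fun a => N.mkQ (linearCombination Quotient.out a)) r)) := by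
      rw [join_eq_subst, linearCombination_subst, linearCombination_map]
      exact hN.mkQ_linearCombination_congr (fun x => (Quotient.out_eq (N.mkQ _)).symm) r
    ext r
    exact key r

/-- The projection of a contramodule onto its quotient by a subcontramodule. -/
noncomputable def quotientMk (hN : IsSubcontramodule N) : A ⟶ hN.quotient :=
  homMk (B := hN.quotient) N.mkQ fun a => by
    change _ = N.mkQ (linearCombination Quotient.out (map _ a))
    rw [linearCombination_map]
    exact hN.mkQ_linearCombination_congr (fun x => (Quotient.out_eq (N.mkQ x)).symm) a

theorem quotientMk_surjective (hN : IsSubcontramodule N) : Function.Surjective hN.quotientMk.f :=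
  N.mkQ_surjective

theorem quotientMk_eq_iff (hN : IsSubcontramodule N) {m n : A.A} :
    hN.quotientMk.f m = hN.quotientMk.f n ↔ m - n ∈ N :=
  Submodule.Quotient.eq N

theorem quotientMk_eq_zero_iff (hN : IsSubcontramodule N) {m : A.A} :
    hN.quotientMk.f m = 0 ↔ m ∈ N := by
  rw [← map_zero (toLinearMap hN.quotientMk), toLinearMap_apply, quotientMk_eq_iff, sub_zero]

end IsSubcontramodule

theorem isSubcontramodule_range (f : A ⟶ B) :
    IsSubcontramodule (LinearMap.range (toLinearMap f)) := fun a => by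
  choose s hs using fun n : LinearMap.range (toLinearMap f) => n.2
  refine ⟨linearCombination s a, ?_⟩
  rw [toLinearMap_apply, hom_linearCombination]
  exact congrArg (linearCombination · a) (funext hs)

theorem surjective_of_epi (f : A ⟶ B) [Epi f] : Function.Surjective f.f := by
  have hN := isSubcontramodule_range f
  let zero : B ⟶ hN.quotient := homMk 0 fun a => by simp [linearCombination_zero]
  have hzero : hN.quotientMk = zero := (cancel_epi f).1 <| hom_ext fun m =>
    hN.quotientMk_eq_zero_iff.2 ⟨m, rfl⟩
  exact fun m => hN.quotientMk_eq_zero_iff.1 (congrArg (fun g => g.f m) hzero)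

end Quotient

section Reduction

variable {H : Ideal R} {A : Contramodule R} {X : Type v}

variable (A) in
/-- The submodule `H ⋌ A` of all infinite linear combinations of elements of `A` with coefficients
in `H`. -/
noncomputable def idealSpan (H : Ideal R) : Submodule R A.A where
  carrier := {m | ∃ h : ConvFam R A.A, (∀ x, h x ∈ H) ∧ A.act h = m}
  add_mem' := by
    rintro _ _ ⟨h, hh, rfl⟩ ⟨k, hk, rfl⟩
    exact ⟨h + k, fun x => H.add_mem (hh x) (hk x), act_add h k⟩
  zero_mem' := ⟨0, fun _ => H.zero_mem, rfl⟩
  smul_mem' := by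
    rintro r _ ⟨h, hh, rfl⟩
    exact ⟨r • h, fun x => H.mul_mem_left r (hh x), act_smul r h⟩

theorem isSubcontramodule_idealSpan (hH : IsClosed (H : Set R)) :
    IsSubcontramodule (A.idealSpan H) := fun a => by
  choose h hh hact using fun n : A.idealSpan H => n.2
  refine ⟨subst a h, subst_apply_mem_of_right hH a hh, ?_⟩
  simp only [← linearCombination_id] at hact
  rw [← linearCombination_id, linearCombination_subst]
  simp only [hact]

variable [H.IsTwoSided]

theorem linearCombination_mem_idealSpan (hH : IsClosed (H : Set R)) {a : ConvFam R X}
    (ha : ∀ x, a x ∈ H) (f : X → A.A) : linearCombination f a ∈ A.idealSpan H :=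
  ⟨map f a, fun y => by
    rw [map_eq_subst]
    exact subst_apply_mem_of_left hH ha _ y, rfl⟩

variable (A) in
/-- The reduction `A / (H ⋌ A)` of a contramodule modulo a closed two-sided ideal. -/
noncomputable abbrev reduction (hH : IsClosed (H : Set R)) : Contramodule R :=
  (isSubcontramodule_idealSpan (A := A) hH).quotient

variable (A) in
/-- The projection of a contramodule onto its reduction. -/
noncomputable abbrev reductionMk (hH : IsClosed (H : Set R)) : A ⟶ A.reduction hH :=
  (isSubcontramodule_idealSpan (A := A) hH).quotientMk

/-- A contramodule is annihilated by `H` if all infinite linear combinations with coefficients in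
`H` vanish. -/
def IsAnnihilatedBy (A : Contramodule R) (H : Ideal R) : Prop := A.idealSpan H = ⊥

theorem IsAnnihilatedBy.linearCombination_eq_zero (hA : A.IsAnnihilatedBy H)
    (hH : IsClosed (H : Set R)) {a : ConvFam R X} (ha : ∀ x, a x ∈ H) (f : X → A.A) :
    linearCombination f a = 0 :=
  (Submodule.mem_bot R).1 (hA ▸ linearCombination_mem_idealSpan hH ha f)

theorem IsAnnihilatedBy.smul_eq_zero (hA : A.IsAnnihilatedBy H) (hH : IsClosed (H : Set R)) {r : R}
    (hr : r ∈ H) (m : A.A) : r • m = 0 := by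
  rw [← linearCombination_point (fun _ => m) (), ← map_smul]
  exact hA.linearCombination_eq_zero hH (fun x => H.mul_mem_right _ hr) _

theorem isAnnihilatedBy_reduction (hH : IsClosed (H : Set R)) :
    (A.reduction hH).IsAnnihilatedBy H := by
  rw [IsAnnihilatedBy, eq_bot_iff]
  rintro _ ⟨a, ha, rfl⟩
  choose g hg using (isSubcontramodule_idealSpan (A := A) hH).quotientMk_surjective
  rw [Submodule.mem_bot, ← linearCombination_id, show id = fun m => (A.reductionMk hH).f (g m) from
    funext fun m => (hg m).symm, ← hom_linearCombination,
    IsSubcontramodule.quotientMk_eq_zero_iff]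
  exact linearCombination_mem_idealSpan hH ha g

end Reduction

end Contramodule

/-! ### Coproducts of projective contramodules -/

namespace Contramodule

open ConvFam

variable {R : Type u} [Ring R] [UniformSpace R] [IsUniformAddGroup R] [IsTopologicalRing R]
  [IsLinearTopology Rᵐᵒᵖ R] [CompleteSpace R] [T2Space R]

section CoprodIdem

variable {X : Type u} {Y : Type v} {e : X → R}

/-- The families `(a_x)` converging to zero with `a_x ∈ R e_x`. -/
abbrev IdemFamily (e : X → R) : Type u := {a : ConvFam R X // ∀ x, a x * e x = a x}

/-- The contramodule of all families `(a_x)` converging to zero with `a_x ∈ R e_x`; for idempotent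
`e_x` it is the coproduct of the projective contramodules `R e_x`. -/
noncomputable def coprodIdem (e : X → R) : Contramodule R where
  A := IdemFamily e
  a := TypeCat.ofHom fun r : ConvFam R (IdemFamily e) =>
    (⟨subst r Subtype.val, fun x => by
      rw [subst_apply, ← (summable_mul r _).tsum_mul_right]
      exact tsum_congr fun a => by rw [mul_assoc, a.2 x]⟩ : IdemFamily e)
  unit := by
    ext a : 3
    exact Subtype.ext (point_subst (R := R) (X := IdemFamily e) a Subtype.val)
  assoc := by
    have key (r : ConvFam R (ConvFam R (IdemFamily e)))
        (h : ConvFam R (IdemFamily e) → IdemFamily e) (hh : ∀ s, (h s).1 = subst s Subtype.val) :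
        subst (join r) Subtype.val = subst (ConvFam.map h r) Subtype.val := by
      simp only [join_eq_subst, map_eq_subst, subst_assoc, point_subst, hh]
    ext r : 3
    exact Subtype.ext (key r _ fun _ => rfl)

/-- The coordinates of an element of `coprodIdem e`. -/
noncomputable def family : (coprodIdem e).A →ₗ[R] ConvFam R X where
  toFun := fun p : IdemFamily e => p.1
  map_add' := fun p q : IdemFamily e =>
    (map_add (substₗ Subtype.val) (point p) (point q)).trans
      (congrArg₂ (· + ·) (point_subst p _) (point_subst q _))
  map_smul' := fun r (p : IdemFamily e) =>
    (map_smul (substₗ Subtype.val) r (point p)).trans (congrArg (r • ·) (point_subst p _))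

theorem family_injective : Function.Injective (family (e := e)) := Subtype.val_injective

theorem family_mul : ∀ (p : (coprodIdem e).A) (x : X), family p x * e x = family p x :=
  fun p : IdemFamily e => p.2

theorem family_linearCombination (f : Y → (coprodIdem e).A) (a : ConvFam R Y) :
    family (linearCombination f a) = subst a fun y => family (f y) := by
  change subst (ConvFam.map f a) family = _
  simp only [map_eq_subst, subst_assoc, point_subst]

variable (he : ∀ x, IsIdempotentElem (e x))

/-- The generators of `coprodIdem e`. -/
noncomputable def generator (x : X) : (coprodIdem e).A :=
  (⟨e x • point x, fun y => by
    by_cases hxy : y = x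
    · rw [hxy, ConvFam.smul_apply, mul_assoc, point_apply_self, one_mul, (he x).eq, mul_one]
    · rw [ConvFam.smul_apply, point_apply_of_ne hxy, mul_zero, zero_mul]⟩ : IdemFamily e)

theorem family_generator (x : X) : family (generator he x) = e x • point x := rfl

theorem linearCombination_generator_family (p : (coprodIdem e).A) :
    linearCombination (generator he) (family p) = p := by
  apply family_injective
  ext x
  simp only [family_linearCombination, family_generator, subst_smul_point_apply, family_mul]

/-- The homomorphism from `coprodIdem e` which sends an element with coordinates `a_x` to
`∑ a_x y_x`. -/
noncomputable def coprodDesc {A : Contramodule R} (y : X → A.A) : coprodIdem e ⟶ A :=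
  homMk (fun p => linearCombination y (family p)) fun r => by
    rw [family_linearCombination, linearCombination_subst]
    rfl

@[simp] theorem coprodDesc_apply {A : Contramodule R} (y : X → A.A) (p : (coprodIdem e).A) :
    (coprodDesc y).f p = linearCombination y (family p) := rfl

include he in
theorem projective_coprodIdem : Projective (coprodIdem e) where
  factors {E B} f g _ := by
    choose y hy using fun x => surjective_of_epi g (f.f (generator he x))
    refine ⟨coprodDesc y, hom_ext fun p => ?_⟩
    simp only [comp_apply, coprodDesc_apply, hom_linearCombination, hy]
    rw [← hom_linearCombination, linearCombination_generator_family]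

end CoprodIdem

section Nilpotent

variable {H : Ideal R} {X : Type u} {e : X → R}

/- The endomorphism extends to the free contramodule on `X` by the identity on the complementary
summand, and there it is the identity modulo `H`. -/
theorem bijective_of_family_sub_mem (hnil : IsTopLeftTNilpotent H)
    (he : ∀ x, IsIdempotentElem (e x)) (f : coprodIdem e ⟶ coprodIdem e)
    (hf : ∀ p x, family (f.f p - p) x ∈ H) : Function.Bijective f.f := by
  let g (x : X) : ConvFam R X :=
    family (f.f (generator he x)) + (point x - family (generator he x))
  have hg (x y : X) : (g x - point x : ConvFam R X) y ∈ H := by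
    have hgx : g x - point x = family (f.f (generator he x) - generator he x) := by
      simp only [g, map_sub]
      abel
    exact hgx ▸ hf _ y
  have subst_g (a : ConvFam R X) : subst a g = family (f.f (linearCombination (generator he) a)) +
      (a - family (linearCombination (generator he) a)) := by
    rw [hom_linearCombination, family_linearCombination, family_linearCombination]
    exact (subst_add a _ _).trans (congrArg _ ((subst_sub a _ _).trans (by rw [subst_point])))
  obtain ⟨hinj, hsurj⟩ := bijective_subst_of_sub_point_mem hnil hg
  constructor
  · intro p q hpq
    apply family_injective
    apply hinj
    simp only [subst_g, linearCombination_generator_family, hpq, sub_self]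
  · intro p
    obtain ⟨a, ha⟩ := hsurj (family p)
    refine ⟨linearCombination (generator he) a, ?_⟩
    have h := congrArg (linearCombination (generator he)) ((subst_g a).symm.trans ha)
    simpa only [map_add, map_sub, linearCombination_generator_family, sub_self, add_zero] using h

/-- Nakayama's lemma for contramodules. -/
theorem surjective_of_surjective_mod (hnil : IsTopLeftTNilpotent H) {A C : Contramodule R}
    (f : A ⟶ C) (hf : ∀ c, ∃ a, c - f.f a ∈ C.idealSpan H) : Function.Surjective f.f := by
  choose s h hh hs using hf
  let g (c : C.A) : ConvFam R C.A := point c - h c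
  have hg (c y : C.A) : (g c - point c : ConvFam R C.A) y ∈ H := by
    rw [show g c - point c = -h c by simp only [g]; abel]
    exact H.neg_mem (hh c y)
  have g_eq (c : C.A) : linearCombination id (g c) = f.f (s c) := by
    rw [map_sub, linearCombination_point, linearCombination_id, hs, id, sub_sub_cancel]
  intro c
  obtain ⟨b, hb⟩ := (bijective_subst_of_sub_point_mem hnil hg).2 (point c)
  refine ⟨linearCombination s b, ?_⟩
  calc f.f (linearCombination s b) = linearCombination (fun c => linearCombination id (g c)) b := by
        simp only [hom_linearCombination, g_eq]
    _ = linearCombination id (point c) := by rw [← linearCombination_subst, ← hb]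
    _ = c := linearCombination_point id c

end Nilpotent

section Basis

variable {H : Ideal R} {X : Type u} {e : X → R}

/-- The elements `d_x` of a contramodule `D` define a surjective homomorphism from `coprodIdem e` to
`D` whose kernel consists of families with all members in `H`. -/
structure IsIdempotentBasis {D : Contramodule R} (H : Ideal R) (e : X → R) (d : X → D.A) :
    Prop where
  isIdempotentElem (x : X) : IsIdempotentElem (e x)
  smul_self (x : X) : e x • d x = d x
  surjective : Function.Surjective (linearCombination d)
  mul_mem (a : ConvFam R X) (ha : linearCombination d a = 0) (x : X) : a x * e x ∈ H

theorem IsIdempotentBasis.exists_isProjectiveCover [H.IsTwoSided] {C : Contramodule R}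
    {hH : IsClosed (H : Set R)} {d : X → (C.reduction hH).A} (hd : IsIdempotentBasis H e d)
    (hnil : IsTopLeftTNilpotent H) : ∃ (P : Contramodule R) (p : P ⟶ C), IsProjectiveCover p := by
  have he := hd.isIdempotentElem
  choose c hc using fun x => (isSubcontramodule_idealSpan hH).quotientMk_surjective (d x)
  let p : coprodIdem e ⟶ C := coprodDesc c
  have mk_p (q : (coprodIdem e).A) : (C.reductionMk hH).f (p.f q) =
      linearCombination d (family q) := by
    simp only [p, coprodDesc_apply, hom_linearCombination, hc]
  refine ⟨coprodIdem e, p, epi_of_surjective p ?_, projective_coprodIdem he, fun f hf => ?_⟩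
  · refine surjective_of_surjective_mod hnil p fun m => ?_
    obtain ⟨a, ha⟩ := hd.surjective ((C.reductionMk hH).f m)
    refine ⟨linearCombination (generator he) a,
      (isSubcontramodule_idealSpan hH).quotientMk_eq_iff.1 ?_⟩
    rw [mk_p, family_linearCombination, linearCombination_subst]
    simp only [family_generator, map_smul, linearCombination_point, hd.smul_self, ha]
  · refine isIso_of_bijective f (bijective_of_family_sub_mem hnil he f fun q x => ?_)
    have hfq : p.f (f.f q) = p.f q := congrArg (fun g => g.f q) hf
    rw [← family_mul]
    exact hd.mul_mem _ (by rw [map_sub, map_sub, ← mk_p, ← mk_p, hfq, sub_self]) x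

end Basis

end Contramodule

/-! ### Lifting idempotents -/

section Idempotents

open Polynomial

/-- The polynomials `p_n` given by Newton's iteration for the equation `p² = p` starting from
`p_0 = X`. -/
noncomputable def idempotentPoly : ℕ → ℤ[X]
  | 0 => X
  | n + 1 => 3 * idempotentPoly n ^ 2 - 2 * idempotentPoly n ^ 3

theorem idempotentPoly_succ_sub (n : ℕ) : idempotentPoly (n + 1) - idempotentPoly n =
    (idempotentPoly n ^ 2 - idempotentPoly n) * (1 - 2 * idempotentPoly n) := by
  rw [idempotentPoly]
  ring

theorem X_sq_sub_X_pow_dvd_idempotentPoly_sq_sub (n : ℕ) :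
    (X ^ 2 - X) ^ (n + 1) ∣ idempotentPoly n ^ 2 - idempotentPoly n := by
  induction n with
  | zero => rw [zero_add, pow_one, idempotentPoly]
  | succ n ih =>
    have quadratic : idempotentPoly (n + 1) ^ 2 - idempotentPoly (n + 1) =
        (idempotentPoly n ^ 2 - idempotentPoly n) * (idempotentPoly n ^ 2 - idempotentPoly n) *
          (4 * (idempotentPoly n ^ 2 - idempotentPoly n) - 3) := by
      rw [idempotentPoly]
      ring
    calc (X ^ 2 - X : ℤ[X]) ^ (n + 1 + 1) ∣ (X ^ 2 - X) ^ (n + 1) * (X ^ 2 - X) ^ (n + 1) := by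
          rw [← pow_add]
          exact pow_dvd_pow _ (by omega)
      _ ∣ _ := quadratic ▸ (mul_dvd_mul ih ih).mul_right _

theorem X_sq_sub_X_pow_dvd_idempotentPoly_succ_sub (n : ℕ) :
    (X ^ 2 - X) ^ (n + 1) ∣ idempotentPoly (n + 1) - idempotentPoly n :=
  idempotentPoly_succ_sub n ▸ (X_sq_sub_X_pow_dvd_idempotentPoly_sq_sub n).mul_right _

theorem X_sq_sub_X_dvd_idempotentPoly_sub_X (n : ℕ) : X ^ 2 - X ∣ idempotentPoly n - X := by
  induction n with
  | zero => rw [idempotentPoly, sub_self]; exact dvd_zero _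
  | succ n ih =>
    rw [← sub_add_sub_cancel (idempotentPoly (n + 1)) (idempotentPoly n)]
    exact ((dvd_pow_self _ n.succ_ne_zero).trans
      (X_sq_sub_X_pow_dvd_idempotentPoly_succ_sub n)).add ih

section Ring

variable {R : Type u} [Ring R] {a : R}

theorem aeval_mem_of_X_sq_sub_X_dvd {H : Ideal R} (ha : a ^ 2 - a ∈ H) {p : ℤ[X]}
    (hp : X ^ 2 - X ∣ p) : aeval a p ∈ H := by
  obtain ⟨q, rfl⟩ := hp
  rw [mul_comm, map_mul]
  simpa only [map_sub, map_pow, aeval_X] using H.mul_mem_left (aeval a q) ha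

theorem tendsto_aeval_of_X_sq_sub_X_pow_dvd [TopologicalSpace R] [IsLinearTopology Rᵐᵒᵖ R]
    (ha : IsTopologicallyNilpotent (a ^ 2 - a)) {p : ℕ → ℤ[X]}
    (hp : ∀ n, (X ^ 2 - X) ^ (n + 1) ∣ p n) :
    Tendsto (fun n => aeval a (p n)) atTop (𝓝 0) := by
  choose q hq using hp
  simp only [hq, map_mul, map_pow, map_sub, aeval_X]
  exact IsLinearTopology.tendsto_mul_zero_of_left _ _ ((tendsto_add_atTop_iff_nat 1).2 ha)

end Ring

variable {R : Type u} [Ring R] [UniformSpace R] [IsUniformAddGroup R] [IsTopologicalRing R]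
  [IsLinearTopology Rᵐᵒᵖ R] [CompleteSpace R] {a : R} {H : Ideal R}

theorem exists_tendsto_aeval_idempotentPoly (ha : IsTopologicallyNilpotent (a ^ 2 - a)) :
    ∃ e, Tendsto (fun n => aeval a (idempotentPoly n)) atTop (𝓝 e) := by
  let b (n : ℕ) : R := aeval a (idempotentPoly n)
  have hb : Tendsto (fun n => b (n + 1) - b n) cofinite (𝓝 0) := by
    rw [Nat.cofinite_eq_atTop]
    simpa only [map_sub] using tendsto_aeval_of_X_sq_sub_X_pow_dvd ha
      X_sq_sub_X_pow_dvd_idempotentPoly_succ_sub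
  have h := (ConvFam.summable hb).hasSum.tendsto_sum_nat
  simp only [Finset.sum_range_sub] at h
  exact ⟨_, by simpa only [sub_add_cancel] using h.add_const (b 0)⟩

theorem exists_isIdempotentElem_sub_mem [T2Space R] (hH : IsClosed (H : Set R))
    (hnil : IsTopologicallyNilpotent (a ^ 2 - a)) (ha : a ^ 2 - a ∈ H) :
    ∃ e, IsIdempotentElem e ∧ e - a ∈ H := by
  obtain ⟨e, he⟩ := exists_tendsto_aeval_idempotentPoly hnil
  refine ⟨e, ?_, hH.mem_of_tendsto (he.sub_const a) (Eventually.of_forall fun n => ?_)⟩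
  · have hzero := tendsto_aeval_of_X_sq_sub_X_pow_dvd hnil X_sq_sub_X_pow_dvd_idempotentPoly_sq_sub
    simp only [map_sub, map_pow] at hzero
    have h := sub_eq_zero.1 (tendsto_nhds_unique ((he.pow 2).sub he) hzero)
    rwa [pow_two] at h
  · simpa only [map_sub, aeval_X, SetLike.mem_coe] using
      aeval_mem_of_X_sq_sub_X_dvd ha (X_sq_sub_X_dvd_idempotentPoly_sub_X n)

end Idempotents

theorem IsTopLeftTNilpotent.isTopologicallyNilpotent {R : Type u} [Ring R] [TopologicalSpace R]
    {H : Ideal R} (hnil : IsTopLeftTNilpotent H) {a : R} (ha : a ∈ H) :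
    IsTopologicallyNilpotent a :=
  (tendsto_add_atTop_iff_nat 1).1 (by simpa using hnil (fun _ => a) fun _ => ha)

/-! ### Modules over semisimple quotient rings -/

section Module

variable {R : Type u} [Ring R] {M : Type v} [AddCommGroup M] [Module R M]

variable (M) in
/-- The submodule of all elements of `M` annihilated by a two-sided ideal `I`. -/
def annihilatedBy (I : Ideal R) [I.IsTwoSided] : Submodule R M where
  carrier := {m | ∀ r ∈ I, r • m = 0}
  add_mem' hm hn r hr := by rw [smul_add, hm r hr, hn r hr, add_zero]
  zero_mem' r _ := smul_zero r
  smul_mem' s m hm r hr := by rw [smul_smul, hm _ (I.mul_mem_right s hr)]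

section Semisimple

variable {S : Type w} [Ring S] {f : R →+* S}

theorem smul_congr_of_mem_annihilatedBy_ker {m : M} (hm : m ∈ annihilatedBy M (RingHom.ker f))
    {r s : R} (h : f r = f s) : r • m = s • m := by
  rw [← sub_eq_zero, ← sub_smul]
  exact hm _ (RingHom.sub_mem_ker_iff f |>.2 h)

variable [IsSemisimpleRing S] (hf : Function.Surjective f)
include hf

theorem isSemisimpleModule_annihilatedBy_ker :
    IsSemisimpleModule R (annihilatedBy M (RingHom.ker f)) := by
  have htors : Module.IsTorsionBySet R (annihilatedBy M (RingHom.ker f)) (RingHom.ker f) :=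
    fun m r => Subtype.ext (m.2 r r.2)
  have : IsSemisimpleRing (R ⧸ RingHom.ker f) :=
    (RingHom.quotientKerEquivOfSurjective hf).symm.isSemisimpleRing
  let := htors.module
  exact htors.isSemisimpleModule_iff.1 inferInstance

theorem exists_isIdempotentElem_smul_eq_zero_iff {m : M}
    (hm : m ∈ annihilatedBy M (RingHom.ker f)) :
    ∃ g : S, IsIdempotentElem g ∧ ∀ t : R, t • m = 0 ↔ f t * g = 0 := by
  let J : Ideal R := LinearMap.ker (LinearMap.toSpanSingleton R M m)
  obtain ⟨g, hg, hJg⟩ := IsSemisimpleRing.ideal_eq_span_idempotent (J.map f)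
  have ker_le : RingHom.ker f ≤ J := hm
  refine ⟨1 - g, hg.one_sub, fun t => ?_⟩
  calc t • m = 0 ↔ t ∈ (J.map f).comap f := by
        rw [Ideal.comap_map_of_surjective' f hf, sup_eq_left.2 ker_le]
        rfl
    _ ↔ ∃ c, c * g = f t := by rw [hJg, Ideal.mem_comap, Ideal.mem_span_singleton']
    _ ↔ f t = f t * g :=
        ⟨fun ⟨c, hc⟩ => by rw [← hc, mul_assoc, hg.eq], fun h => ⟨f t, h.symm⟩⟩
    _ ↔ f t * (1 - g) = 0 := by rw [mul_sub, mul_one, sub_eq_zero]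

end Semisimple

theorem le_sSup_isAtom_of_isSemisimpleModule (N : Submodule R M) [IsSemisimpleModule R N] :
    N ≤ sSup {L : Submodule R M | IsAtom L} := by
  rw [← Submodule.range_subtype N, LinearMap.range_eq_map,
    ← IsSemisimpleModule.sSup_simples_eq_top R N, Submodule.map_le_iff_le_comap, sSup_le_iff]
  intro L (hL : IsSimpleModule R L)
  rw [← Submodule.map_le_iff_le_comap]
  exact le_sSup <| isSimpleModule_iff_isAtom.1 <|
    (Submodule.equivMapOfInjective N.subtype N.subtype_injective L).isSimpleModule_iff.1 hL

variable (R M) in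
/-- The socle of a module is a direct sum of simple cyclic submodules. -/
theorem exists_iSupIndep_isAtom_span_singleton : ∃ (ι : Type v) (m : ι → M),
    (iSupIndep fun i => Submodule.span R {m i}) ∧ (∀ i, IsAtom (Submodule.span R {m i})) ∧
      Submodule.span R (Set.range m) = sSup {L : Submodule R M | IsAtom L} := by
  obtain ⟨s, hindep, hsup, hatom⟩ :=
    exists_sSupIndep_of_sSup_atoms (sSup {L : Submodule R M | IsAtom L}) <| by
      congr! 3 with L
      exact and_iff_right_of_imp fun hL => le_sSup hL
  have hgen (L : s) : ∃ m, Submodule.span R {m} = (L : Submodule R M) := by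
    obtain ⟨m, hmL, hm⟩ := (Submodule.ne_bot_iff _).1 (hatom L.2).ne_bot
    refine ⟨m, ((hatom L.2).le_iff_eq ?_).1 ((Submodule.span_singleton_le_iff_mem m _).2 hmL)⟩
    rwa [Ne, Submodule.span_singleton_eq_bot]
  choose m hm using hgen
  refine ⟨s, m, ?_, fun L => (hm L).symm ▸ hatom L.2, ?_⟩
  · simpa only [hm] using (sSupIndep_iff s).1 hindep
  · rw [← hsup, sSup_eq_iSup', Submodule.span_range_eq_iSup]
    simp only [hm]

end Module

/-! ### Contramodules over products of semisimple rings -/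

namespace ConvFam

variable {R : Type u} [Ring R] [UniformSpace R] [IsTopologicalRing R] {X : Type v} {Y : Type w}

theorem map_subst_apply_of_forall_ne [IsUniformAddGroup R] [IsLinearTopology Rᵐᵒᵖ R]
    [CompleteSpace R] [T2Space R] {S : Type*} [Ring S] {f : R →+* S}
    (hf : IsClosed (RingHom.ker f : Set R)) {a : ConvFam R X} {x₀ : X}
    (ha : ∀ x ≠ x₀, f (a x) = 0) (g : X → ConvFam R Y) (y : Y) :
    f (subst a g y) = f (a x₀) * f (g x₀ y) := by
  have hmem (x : X) : (a - a x₀ • point x₀ : ConvFam R X) x ∈ RingHom.ker f := by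
    by_cases hx : x = x₀
    · simp [hx]
    · simp [RingHom.mem_ker, point_apply_of_ne hx, ha x hx]
  have h : f (subst (a - a x₀ • point x₀) g y) = 0 := subst_apply_mem_of_left hf hmem g y
  rwa [← substₗ_apply, map_sub, map_smul, substₗ_apply, substₗ_apply, point_subst, sub_apply,
    ConvFam.smul_apply, map_sub, map_mul, sub_eq_zero] at h

theorem sum_smul_point_apply [DecidableEq X] (F : Finset X) (r : X → R) (x : X) :
    (∑ y ∈ F, r y • point y : ConvFam R X) x = if x ∈ F then r x else 0 := by
  induction F using Finset.induction_on with
  | empty => simp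
  | insert y F hy ih =>
    rw [Finset.sum_insert hy, add_apply, ih, ConvFam.smul_apply]
    by_cases hxy : x = y
    · simp [hxy, hy]
    · simp [hxy, point_apply_of_ne hxy]

end ConvFam

/-- The surjective homomorphisms `φ γ` with open kernels induce an embedding of `R / H` into the
product of the discrete rings `S γ`, and the idempotents of the product with one component equal to
`1` and all the others equal to `0` lift to a family `u` converging to zero in `R`. -/
structure IsProductReduction {R : Type u} [Ring R] [UniformSpace R] (H : Ideal R) {Γ : Type v}
    {S : Γ → Type w} [∀ γ, Ring (S γ)] (φ : ∀ γ, R →+* S γ) (u : ConvFam R Γ) : Prop where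
  isOpen_ker (γ : Γ) : IsOpen (RingHom.ker (φ γ) : Set R)
  surjective (γ : Γ) : Function.Surjective (φ γ)
  mem_iff {r : R} : r ∈ H ↔ ∀ γ, φ γ r = 0
  apply_self (γ : Γ) : φ γ (u γ) = 1
  apply_of_ne {γ δ : Γ} (h : γ ≠ δ) : φ γ (u δ) = 0

namespace IsProductReduction

open ConvFam Contramodule

variable {R : Type u} [Ring R] [UniformSpace R] {H : Ideal R} {Γ : Type v} {S : Γ → Type w}
  [∀ γ, Ring (S γ)] {φ : ∀ γ, R →+* S γ} {u : ConvFam R Γ}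
  (hφ : IsProductReduction H φ u)
include hφ

theorem mul_mem {r : R} {γ : Γ} (hr : φ γ r = 0) : r * u γ ∈ H :=
  hφ.mem_iff.2 fun δ => by
    obtain rfl | hδ := eq_or_ne δ γ
    · rw [map_mul, hr, zero_mul]
    · rw [map_mul, hφ.apply_of_ne hδ, mul_zero]

theorem smul_eq_self {M : Type*} [AddCommGroup M] [Module R M] {m : M} {γ : Γ}
    (hm : m ∈ annihilatedBy M (RingHom.ker (φ γ))) : u γ • m = m := by
  rw [smul_congr_of_mem_annihilatedBy_ker hm ((hφ.apply_self γ).trans (map_one _).symm), one_smul]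

variable [IsTopologicalRing R]

theorem isClosed_ker (γ : Γ) : IsClosed (RingHom.ker (φ γ) : Set R) :=
  AddSubgroup.isClosed_of_isOpen (RingHom.ker (φ γ)).toAddSubgroup (hφ.isOpen_ker γ)

theorem isClosed : IsClosed (H : Set R) := by
  have h : (H : Set R) = ⋂ γ, (RingHom.ker (φ γ) : Set R) := by
    ext r
    simpa only [Set.mem_iInter, SetLike.mem_coe, RingHom.mem_ker] using hφ.mem_iff
  exact h ▸ isClosed_iInter hφ.isClosed_ker

theorem exists_isIdempotentElem_smul_eq_zero_iff [T2Space R] [IsUniformAddGroup R]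
    [IsLinearTopology Rᵐᵒᵖ R] [CompleteSpace R] {M : Type*} [AddCommGroup M] [Module R M]
    [∀ γ, IsSemisimpleRing (S γ)] (hnil : IsTopLeftTNilpotent H) {m : M} {γ : Γ}
    (hm : m ∈ annihilatedBy M (RingHom.ker (φ γ))) :
    ∃ e : R, IsIdempotentElem e ∧ ∀ t : R, t • m = 0 ↔ t * e ∈ H := by
  obtain ⟨g, hg, hmg⟩ := _root_.exists_isIdempotentElem_smul_eq_zero_iff (hφ.surjective γ) hm
  obtain ⟨r, rfl⟩ := hφ.surjective γ g
  have ha : (r * u γ) ^ 2 - r * u γ ∈ H := by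
    have h : (r * u γ * r - r) * u γ ∈ H := hφ.mul_mem <| by
      rw [map_sub, map_mul, map_mul, hφ.apply_self, mul_one, hg.eq, sub_self]
    rwa [sub_mul, mul_assoc, ← sq] at h
  obtain ⟨e, he, hea⟩ :=
    exists_isIdempotentElem_sub_mem hφ.isClosed (hnil.isTopologicallyNilpotent ha) ha
  refine ⟨e, he, fun t => ?_⟩
  have hte : t * e ∈ H ↔ t * (r * u γ) ∈ H := by
    rw [← sub_add_cancel (t * e) (t * (r * u γ)), ← mul_sub]
    exact H.add_mem_iff_right (H.mul_mem_left t hea)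
  rw [hmg, hte, ← mul_assoc, ← map_mul]
  refine ⟨hφ.mul_mem, fun h => ?_⟩
  simpa only [map_mul, hφ.apply_self, mul_one] using hφ.mem_iff.1 h γ

variable [IsUniformAddGroup R] [IsLinearTopology Rᵐᵒᵖ R] [CompleteSpace R] [T2Space R]
  [H.IsTwoSided]

section Component

variable {D : Contramodule R} (hD : D.IsAnnihilatedBy H) {m : D.A} {γ : Γ}
include hD

theorem smul_mem_annihilatedBy (m : D.A) (γ : Γ) :
    u γ • m ∈ annihilatedBy D.A (RingHom.ker (φ γ)) := fun r hr => by
  rw [smul_smul]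
  exact hD.smul_eq_zero hφ.isClosed (hφ.mul_mem hr) m

theorem linearCombination_smul (m : D.A) : linearCombination (fun γ => u γ • m) u = m := by
  let a : ConvFam R Unit := subst u fun γ => u γ • point ()
  have ha (i : Unit) : (a - point () : ConvFam R Unit) i ∈ H := hφ.mem_iff.2 fun γ => by
    rw [ConvFam.sub_apply, map_sub, map_subst_apply_of_forall_ne (hφ.isClosed_ker γ)
      (fun δ hδ => hφ.apply_of_ne hδ.symm)]
    simp [hφ.apply_self]
  have h := hD.linearCombination_eq_zero hφ.isClosed ha fun _ => m
  rw [map_sub, linearCombination_point, sub_eq_zero, linearCombination_subst] at h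
  simpa only [map_smul, linearCombination_point] using h

theorem exists_mem_annihilatedBy_of_isAtom (hm : IsAtom (Submodule.span R {m})) :
    ∃ γ, m ∈ annihilatedBy D.A (RingHom.ker (φ γ)) := by
  obtain ⟨γ, hγ⟩ : ∃ γ, u γ • m ≠ 0 := by
    by_contra! h
    refine hm.1 (Submodule.span_singleton_eq_bot.2 ?_)
    rw [← hφ.linearCombination_smul hD m, show (fun γ => u γ • m) = 0 from funext h,
      linearCombination_zero, LinearMap.zero_apply]
  have hspan : Submodule.span R {u γ • m} = Submodule.span R {m} :=
    (hm.le_iff_eq (mt Submodule.span_singleton_eq_bot.1 hγ)).1 (Submodule.span_singleton_smul_le ..)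
  refine ⟨γ, (Submodule.span_singleton_le_iff_mem _ _).1 ?_⟩
  rw [← hspan, Submodule.span_singleton_le_iff_mem]
  exact hφ.smul_mem_annihilatedBy hD m γ

end Component

section LinearCombination

variable {D : Contramodule R} (hD : D.IsAnnihilatedBy H) {X : Type*} {d : X → D.A}
include hD

theorem linearCombination_eq_zero {c : X → Γ}
    (hd : ∀ x, d x ∈ annihilatedBy D.A (RingHom.ker (φ (c x)))) {a : ConvFam R X}
    (ha : ∀ x, φ (c x) (a x) = 0) : linearCombination d a = 0 := by
  have h := hD.linearCombination_eq_zero hφ.isClosed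
    (a := subst a fun x => u (c x) • point x)
    (fun x => by rw [subst_smul_point_apply]; exact hφ.mul_mem (ha x)) d
  simpa only [linearCombination_subst, map_smul, linearCombination_point,
    hφ.smul_eq_self (hd _)] using h

/- For the component `γ` of `d_x`, only finitely many terms of `u_γ ∑ a_y d_y` survive. -/
theorem smul_eq_zero_of_linearCombination_eq_zero {c : X → Γ}
    (hd : ∀ x, d x ∈ annihilatedBy D.A (RingHom.ker (φ (c x))))
    (hindep : iSupIndep fun x => Submodule.span R {d x}) {a : ConvFam R X}
    (ha : linearCombination d a = 0) (x : X) : a x • d x = 0 := by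
  classical
  have hfin : {y | c y = c x ∧ φ (c y) (a y) ≠ 0}.Finite :=
    (show {y | φ (c x) (a y) ≠ 0}.Finite from
      a.2 ((hφ.isOpen_ker (c x)).mem_nhds (map_zero _))).subset fun y hy => hy.1 ▸ hy.2
  let F : Finset X := hfin.toFinset
  have memF (y : X) : y ∈ F ↔ c y = c x ∧ φ (c y) (a y) ≠ 0 := hfin.mem_toFinset
  have hsum : ∑ y ∈ F, a y • d y = 0 := by
    have h := hφ.linearCombination_eq_zero hD hd
      (a := u (c x) • a - ∑ y ∈ F, a y • point y) fun y => by
        rw [ConvFam.sub_apply, sum_smul_point_apply, ConvFam.smul_apply]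
        by_cases hy : c y = c x
        · have hu : φ (c y) (u (c x)) = 1 := by rw [← hy, hφ.apply_self]
          by_cases hya : φ (c y) (a y) = 0 <;> simp [memF, hy, hya, hu]
        · simp [memF, hy, hφ.apply_of_ne hy]
    simpa only [map_sub, map_smul, map_sum, ha, linearCombination_point, smul_zero, zero_sub,
      neg_eq_zero] using h
  by_cases hx : φ (c x) (a x) = 0
  · exact hd x _ hx
  · exact iSupIndep_iff_finsetSum_eq_zero_imp_eq_zero _ |>.1 hindep F (fun y => a y • d y)
      (fun y _ => Submodule.smul_mem _ _ (Submodule.mem_span_singleton_self _)) hsum x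
      ((memF x).2 ⟨rfl, hx⟩)

theorem surjective_linearCombination
    (hd : ∀ γ, annihilatedBy D.A (RingHom.ker (φ γ)) ≤ Submodule.span R (Set.range d)) :
    Function.Surjective (linearCombination d) := by
  have hspan : Submodule.span R (Set.range d) ≤ LinearMap.range (linearCombination d) :=
    Submodule.span_le.2 <| Set.range_subset_iff.2 fun x => ⟨point x, linearCombination_point d x⟩
  intro m
  choose τ hτ using fun γ => hspan (hd γ (hφ.smul_mem_annihilatedBy hD m γ))
  refine ⟨subst u τ, ?_⟩
  rw [linearCombination_subst, funext hτ, hφ.linearCombination_smul hD]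

end LinearCombination

section Semisimple

variable [∀ γ, IsSemisimpleRing (S γ)] (hnil : IsTopLeftTNilpotent H)
include hnil

/- The socle of `D` as an abstract module is the direct sum of the components of `D`; hence a direct
decomposition of the socle into simple submodules generates `D` as a contramodule. -/
theorem exists_isIdempotentBasis {D : Contramodule R} (hD : D.IsAnnihilatedBy H) :
    ∃ (X : Type u) (e : X → R) (d : X → D.A), IsIdempotentBasis H e d := by
  obtain ⟨X, d, hindep, hatom, hspan⟩ := exists_iSupIndep_isAtom_span_singleton R D.A
  choose c hc using fun x => hφ.exists_mem_annihilatedBy_of_isAtom hD (hatom x)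
  choose e he hde using fun x =>
    hφ.exists_isIdempotentElem_smul_eq_zero_iff hnil (hc x)
  refine ⟨X, e, d, he, fun x => ?_, hφ.surjective_linearCombination hD fun γ => ?_,
    fun a ha x => ?_⟩
  · have h : (1 - e x) • d x = 0 :=
      (hde x _).2 <| by rw [sub_mul, one_mul, (he x).eq, sub_self]; exact H.zero_mem
    rw [sub_smul, one_smul, sub_eq_zero] at h
    exact h.symm
  · have := isSemisimpleModule_annihilatedBy_ker (M := D.A) (hφ.surjective γ)
    exact hspan ▸ le_sSup_isAtom_of_isSemisimpleModule _
  · exact (hde x _).1 (hφ.smul_eq_zero_of_linearCombination_eq_zero hD hc hindep ha x)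

theorem exists_isProjectiveCover (C : Contramodule R) :
    ∃ (P : Contramodule R) (p : P ⟶ C), IsProjectiveCover p :=
  have ⟨_, _, _, hd⟩ :=
    hφ.exists_isIdempotentBasis hnil (isAnnihilatedBy_reduction (A := C) hφ.isClosed)
  hd.exists_isProjectiveCover hnil

end Semisimple

end IsProductReduction

section Main

variable {R : Type u} [Ring R] [UniformSpace R] {H : Ideal R} [H.IsTwoSided] {Γ : Type v}
  {S : Γ → Type w} [∀ γ, Ring (S γ)]

theorem tendsto_pi_single {ι : Type*} [DecidableEq ι] {A : ι → Type*} [∀ i, Zero (A i)]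
    [∀ i, TopologicalSpace (A i)] (a : ∀ i, A i) :
    Tendsto (fun i => Pi.single i (a i)) cofinite (𝓝 0) := by
  refine tendsto_pi_nhds.2 fun i => tendsto_nhds_of_eventually_eq ?_
  filter_upwards [(Set.finite_singleton i).compl_mem_cofinite] with j hj
  exact Pi.single_eq_of_ne (Ne.symm hj) _

theorem small_of_ringEquiv_pi {Q : Type u} [Ring Q] (e : Q ≃+* ∀ γ, S γ) :
    Small.{u} {γ // Nontrivial (S γ)} := by
  classical
  refine small_of_injective (f := fun γ => e.symm (Pi.single γ.1 1)) fun γ δ h => ?_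
  have := γ.2
  by_contra hne
  have h1 := congr_fun (e.symm.injective h) γ
  rw [Pi.single_eq_same, Pi.single_eq_of_ne (Subtype.coe_ne_coe.2 hne)] at h1
  exact one_ne_zero h1

theorem exists_lift_of_small
    (hlift : ∀ (X : Type u) (b : X → R ⧸ H), Tendsto b cofinite (𝓝 0) →
      ∃ a : X → R, Tendsto a cofinite (𝓝 0) ∧ ∀ x, Ideal.Quotient.mk H (a x) = b x)
    {X : Type*} [Small.{u} X] {b : X → R ⧸ H} (hb : Tendsto b cofinite (𝓝 0)) :
    ∃ a : ConvFam R X, ∀ x, Ideal.Quotient.mk H (a x) = b x := by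
  obtain ⟨a, ha, hab⟩ := hlift _ (b ∘ (equivShrink.{u} X).symm)
    (hb.comp (equivShrink X).symm.injective.tendsto_cofinite)
  refine ⟨⟨a ∘ equivShrink X, ha.comp (equivShrink X).injective.tendsto_cofinite⟩, fun x => ?_⟩
  simpa using hab (equivShrink X x)

theorem exists_isProductReduction [∀ γ, TopologicalSpace (S γ)] [∀ γ, DiscreteTopology (S γ)]
    (hlift : ∀ (X : Type u) (b : X → R ⧸ H), Tendsto b cofinite (𝓝 0) →
      ∃ a : X → R, Tendsto a cofinite (𝓝 0) ∧ ∀ x, Ideal.Quotient.mk H (a x) = b x)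
    (e : (R ⧸ H) ≃+* (∀ γ, S γ)) (he : IsHomeomorph e) :
    ∃ u : ConvFam R {γ // Nontrivial (S γ)}, IsProductReduction H
      (fun γ : {γ // Nontrivial (S γ)} =>
        ((Pi.evalRingHom S γ).comp e.toRingHom).comp (Ideal.Quotient.mk H)) u := by
  classical
  have := small_of_ringEquiv_pi e
  have hsymm : Tendsto e.symm (𝓝 0) (𝓝 0) := by
    have h := (he.homeomorph e).symm.continuous.tendsto 0
    have heq : ⇑(he.homeomorph e).symm = e.symm := funext fun s => e.injective <|
      ((he.homeomorph e).apply_symm_apply s).trans (e.apply_symm_apply s).symm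
    rwa [heq, map_zero] at h
  have hval := (Subtype.val_injective (p := fun γ => Nontrivial (S γ))).tendsto_cofinite
  obtain ⟨u, hu⟩ := exists_lift_of_small hlift
    (hsymm.comp ((tendsto_pi_single fun _ => 1).comp hval))
  have hcont (γ : Γ) : Continuous fun r : R => e (Ideal.Quotient.mk H r) γ :=
    (continuous_apply γ).comp (he.continuous.comp continuous_quot_mk)
  refine ⟨u, fun γ => (isOpen_discrete {(0 : S γ)}).preimage (hcont γ.1), fun γ =>
    ((Function.surjective_eval γ.1).comp e.surjective).comp Ideal.Quotient.mk_surjective,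
    fun {r} => ?_, fun γ => ?_, fun {γ δ} h => ?_⟩
  · rw [← Ideal.Quotient.eq_zero_iff_mem, ← map_eq_zero_iff e e.injective, funext_iff]
    refine ⟨fun h γ => h γ, fun h γ => ?_⟩
    by_cases hγ : Nontrivial (S γ)
    · exact h ⟨γ, hγ⟩
    · exact (not_nontrivial_iff_subsingleton.1 hγ).elim _ _
  · simp [hu]
  · simp [hu, Pi.single_eq_of_ne (Subtype.coe_ne_coe.2 h)]

end Main

theorem theorem9p4_general {R : Type u} [Ring R] [UniformSpace R] [IsUniformAddGroup R]
    [IsTopologicalRing R] [IsLinearTopology Rᵐᵒᵖ R] [CompleteSpace R] [T2Space R]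
    (H : Ideal R) [H.IsTwoSided]
    (hlift : ∀ (X : Type u) (b : X → R ⧸ H), Tendsto b cofinite (𝓝 0) →
      ∃ a : X → R, Tendsto a cofinite (𝓝 0) ∧ ∀ x, Ideal.Quotient.mk H (a x) = b x)
    (hnil : IsTopLeftTNilpotent H)
    {Γ : Type v} (S : Γ → Type w) [∀ γ, Ring (S γ)] [∀ γ, IsSemisimpleRing (S γ)]
    [∀ γ, TopologicalSpace (S γ)] [∀ γ, DiscreteTopology (S γ)]
    (e : (R ⧸ H) ≃+* (∀ γ, S γ)) (he : IsHomeomorph e)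
    (C : Contramodule R) :
    ∃ (P : Contramodule R) (p : P ⟶ C), IsProjectiveCover p :=
  have ⟨_, hu⟩ := exists_isProductReduction hlift e he
  hu.exists_isProjectiveCover hnil C

theorem theorem9p4 {R : Type u} [Ring R] [UniformSpace R] [IsUniformAddGroup R]
    [IsTopologicalRing R] [IsLinearTopology Rᵐᵒᵖ R] [CompleteSpace R] [T2Space R]
    (H : Ideal R) [H.IsTwoSided]
    (hclosed : IsStronglyClosed H.toAddSubgroup)
    (hnil : IsTopLeftTNilpotent H)
    {Γ : Type v} (S : Γ → Type w) [∀ γ, Ring (S γ)]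
    [∀ γ, IsSimpleRing (S γ)] [∀ γ, IsArtinianRing (S γ)]
    [∀ γ, TopologicalSpace (S γ)] [∀ γ, DiscreteTopology (S γ)]
    (e : (R ⧸ H) ≃+* (∀ γ, S γ)) (he : IsHomeomorph e)
    (C : Contramodule R) :
    ∃ (P : Contramodule R) (p : P ⟶ C), IsProjectiveCover p :=
  theorem9p4_general H hclosed.lift hnil S e he C
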